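/- **Setting.** Let $P_{X,1},\dots,P_{X,d}$ be probability distributions on a feature space, let $P_{Y\mid X}$ be a conditional distribution of labels given features, and put $P_i=P_{X,i}\times P_{Y\mid X}$ (the source domains). Let $\pi_i,\pi_i'\ge 0$ with $\sum_i\pi_i=\sum_i\pi'_i=1$, and $\pi_i'=0$ whenever $\pi_i=0$. The target distribution is $P'=\big(\sum_i\pi_i'P_{X,i}\big)\times P_{Y\mid X}$. Let $\mathcal L$ be a measurable loss function with $|\mathcal L|\le c_L$. For a predictor $h$ write $\mathcal E'(h)=\mathbb E_{(x,y)\sim P'}\mathcal L(y,h(x))$. Let $n,m\ge 1$ be such that $n_i=\pi_i n$ and $\tilde n_i=\pi_i m$ are integers for all $i$. Let $D_i$ be a sample of size $n_i$ and $\widetilde D_i$ a sample of size $\tilde n_i$ from $P_i$, all observations being independent; $\widehat{\mathcal E}_i$, $\widetilde{\mathcal E}_i$ and $\widehat{\mathcal E}^{\cup}_i$ denote the empirical risks on $D_i$, on $\widetilde D_i$ and on the union of both samples (of size $n_i+\tilde n_i$). Predictors learned from samples are measurable functions of the samples and the feature. The VC-dimension of a hypothesis space $\mathcal H$ of predictors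 (with values in any prediction space) is understood as the VC-dimension of the induced class of functions $(x,y)\mapsto\mathcal L(y,h(x))$, $h\in\mathcal H$, i.e. of the family of their subgraphs $\{(x,y,\beta):\beta<\mathcal L(y,h(x))\}$. For binary classifiers it is at most the classical VC-dimension of $\mathcal H$, with equality for the zero-one loss with binary labels. **Theorem.** There is a constant $C>0$, depending only on $c_L$ and $\pi=(\pi_1,\dots,\pi_d)$, such that in every such setting the following holds for every $\delta\in(0,1)$. (a) Let $\mathcal H_i$ and $\widetilde{\mathcal H}$ be hypothesis spaces of VC-dimension at most $d_i$ and $\tilde d$. Let $\hat f_i$ minimize $\widehat{\mathcal E}_i$ over $\mathcal H_i$, and let $\tilde f=\mathcal A(\hat f_1,\dots,\hat f_d;\widetilde D)\in\widetilde{\mathcal H}$, where the aggregation algorithm $\mathcal A$ guarantees that almost surely $\widetilde{\mathcal E}_i(\tilde f)\le\widetilde{\mathcal E}_i(\hat f_i)$ for all $i$. Then, with probability at least $1-3d\delta$, $$\mathcal E'(\tilde f)-\sum_{i=1}^d\pi_i'\widehat{\mathcal E}_i(\hat f_i)\le\Big(\sum_{i=1}^d\frac{\pi'_i}{\sqrt{\pi_i}}\Big)\sqrt{\frac{c_L\log(1/\delta)}{2m}}+C\sqrt{\frac{\tilde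 d\log m+\log(1/\delta)}{m}}+C\sum_{i=1}^d\pi'_i\sqrt{\frac{d_i\log n_i+\log(1/\delta)}{n_i}}.$$ (b) Let $\mathcal H$ be a hypothesis space of VC-dimension at most $d_0$, let $N=n+m$, and let $\hat f$ minimize the empirical risk $\sum_i\pi_i\widehat{\mathcal E}^{\cup}_i$ of the union of all samples over $\mathcal H$. Then, with probability at least $1-d\delta$, $$\mathcal E'(\hat f)-\sum_{i=1}^d\pi_i'\widehat{\mathcal E}^{\cup}_i(\hat f)\le C\sqrt{\frac{d_0\log N+\log(1/\delta)}{N}}.$$ (Terms with $\pi_i=\pi'_i=0$ are read as $0$.) -/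

import Mathlib

open MeasureTheory ProbabilityTheory

namespace DomainMixture

section VC

variable {Z : Type*}

/-- The family of sets `𝒞` shatters the finite set `s`: every subset of `s` is cut out by a
member of `𝒞`. -/
def Shatters (𝒞 : Set (Set Z)) (s : Finset Z) : Prop :=
  ∀ t ⊆ s, ∃ u ∈ 𝒞, ∀ z ∈ s, z ∈ u ↔ z ∈ t

/-- The Vapnik-Chervonenkis dimension of a family of sets: the supremum of the cardinalities of
the finite sets it shatters. -/
noncomputable def vcDim (𝒞 : Set (Set Z)) : ℕ∞ :=
  ⨆ (s : Finset Z) (_ : Shatters 𝒞 s), (s.card : ℕ∞)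

end VC

section Hypotheses

variable {X Y A : Type*}

/-- The subgraph of the loss function `(x, y) ↦ L(y, h(x))` of a predictor `h`. -/
def lossSubgraph (L : Y → A → ℝ) (h : X → A) : Set ((X × Y) × ℝ) :=
  {p | p.2 < L p.1.2 (h p.1.1)}

/-- The VC dimension of a hypothesis space `H` of predictors with values in an arbitrary
prediction space, under the loss `L`: the VC dimension of the class of real functions
`(x, y) ↦ L(y, h(x))`, `h ∈ H`, that is, of the family of their subgraphs.  For binary
classifiers it is bounded by the classical VC dimension (`hypVCDim_le_binaryVCDim`), with
equality for the zero-one loss (`hypVCDim_zeroOne`). -/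
noncomputable def hypVCDim (L : Y → A → ℝ) (H : Set (X → A)) : ℕ∞ :=
  vcDim (lossSubgraph L '' H)

/-- The classical VC dimension of a class of binary classifiers. -/
noncomputable def binaryVCDim (H : Set (X → Bool)) : ℕ∞ :=
  vcDim ((fun h : X → Bool => {x | h x = true}) '' H)

/-- The zero-one loss of binary classification. -/
noncomputable def zeroOneLoss (y a : Bool) : ℝ := if y = a then 0 else 1

/-- For binary classifiers and any loss, `hypVCDim` is at most the classical VC dimension. -/
theorem hypVCDim_le_binaryVCDim (L : Y → Bool → ℝ) (H : Set (X → Bool)) :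
    hypVCDim L H ≤ binaryVCDim H := by
  classical
  unfold hypVCDim binaryVCDim vcDim
  refine iSup₂_le fun s hs => ?_
  -- for a point `p` of a shattered set, the test `p ∈ lossSubgraph L h` depends on `h` exactly
  -- through the value `h p.1.1`
  have key : ∀ p ∈ s, ∀ h g : X → Bool,
      (p ∈ lossSubgraph L h ↔ p ∈ lossSubgraph L g) ↔ h p.1.1 = g p.1.1 := by
    intro p hp h g
    obtain ⟨_, ⟨a, _, rfl⟩, ha⟩ := hs {p} (by simpa using hp)
    obtain ⟨_, ⟨b, _, rfl⟩, hb⟩ := hs ∅ (by simp)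
    have h1 : p ∈ lossSubgraph L a := by simpa using ha p hp
    have h2 : p ∉ lossSubgraph L b := by simpa using hb p hp
    simp only [lossSubgraph, Set.mem_ofPred_eq] at h1 h2 ⊢
    cases ea : a p.1.1 <;> cases eb : b p.1.1 <;> cases eh : h p.1.1 <;> cases eg : g p.1.1 <;>
      simp_all
  have inj : Set.InjOn (fun p : (X × Y) × ℝ => p.1.1) s := by
    intro p hp q hq hpq
    by_contra hne
    obtain ⟨_, ⟨a, _, rfl⟩, ha⟩ := hs {p} (by simpa using hp)
    obtain ⟨_, ⟨b, _, rfl⟩, hb⟩ := hs ∅ (by simp)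
    have e1 : ¬ (p ∈ lossSubgraph L a ↔ p ∈ lossSubgraph L b) := by
      rw [ha p hp, hb p hp]; simp
    have e2 : q ∈ lossSubgraph L a ↔ q ∈ lossSubgraph L b := by
      rw [ha q hq, hb q hq]; simp [Ne.symm hne]
    rw [key p hp] at e1
    rw [key q hq] at e2
    simp only at hpq
    rw [← hpq] at e2
    exact e1 e2
  have hcard : (s.image fun p => p.1.1).card = s.card := Finset.card_image_of_injOn inj
  rw [← hcard]
  refine le_iSup₂_of_le (s.image fun p => p.1.1) ?_ le_rfl
  obtain ⟨_, ⟨b, _, rfl⟩, hb⟩ := hs ∅ (by simp)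
  intro t _
  obtain ⟨_, ⟨a, haH, rfl⟩, ha⟩ := hs (s.filter fun p => ¬ (p.1.1 ∈ t ↔ b p.1.1 = true))
    (Finset.filter_subset _ _)
  refine ⟨_, ⟨a, haH, rfl⟩, ?_⟩
  intro x hx
  obtain ⟨p, hp, rfl⟩ := Finset.mem_image.1 hx
  have e1 := ha p hp
  have e2 := hb p hp
  have e3 := key p hp a b
  simp only [Finset.mem_filter, hp, true_and, Finset.notMem_empty, iff_false] at e1 e2
  simp only [e1, e2, iff_false, not_not] at e3
  simp only [Set.mem_ofPred_eq]
  cases ea : a p.1.1 <;> cases eb : b p.1.1 <;> simp_all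

/-- For binary classifiers and the zero-one loss, `hypVCDim` is the classical VC dimension. -/
theorem hypVCDim_zeroOne (H : Set (X → Bool)) : hypVCDim zeroOneLoss H = binaryVCDim H := by
  classical
  refine le_antisymm (hypVCDim_le_binaryVCDim _ _) ?_
  unfold hypVCDim binaryVCDim vcDim
  refine iSup₂_le fun s hs => ?_
  have inj : Function.Injective (fun x : X => ((x, false), (0 : ℝ))) := by
    intro x y hxy
    simpa using hxy
  rw [← Finset.card_image_of_injective s inj]
  refine le_iSup₂_of_le (s.image fun x : X => ((x, false), (0 : ℝ))) ?_ le_rfl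
  intro t _
  obtain ⟨_, ⟨a, haH, rfl⟩, ha⟩ := hs (s.filter fun x => ((x, false), (0 : ℝ)) ∈ t)
    (Finset.filter_subset _ _)
  refine ⟨_, ⟨a, haH, rfl⟩, ?_⟩
  intro p hp
  obtain ⟨x, hx, rfl⟩ := Finset.mem_image.1 hp
  have e := ha x hx
  simp only [Finset.mem_filter, hx, true_and, Set.mem_ofPred_eq] at e
  rw [← e]
  cases ea : a x <;> simp [lossSubgraph, zeroOneLoss, ea]

/-- The empirical risk of the predictor `h` on the sample `D` of size `k`. -/
noncomputable def empRisk (L : Y → A → ℝ) {k : ℕ} (D : Fin k → X × Y) (h : X → A) : ℝ :=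
  (k : ℝ)⁻¹ * ∑ j, L (D j).2 (h (D j).1)

/-- `f` minimizes the criterion `R` over the hypothesis space `H`. -/
def IsMinimizer (R : (X → A) → ℝ) (H : Set (X → A)) (f : X → A) : Prop :=
  f ∈ H ∧ ∀ g ∈ H, R f ≤ R g

variable [MeasurableSpace X] [MeasurableSpace Y]

/-- The risk of the predictor `h` under the distribution `P` of a feature-label pair. -/
noncomputable def risk (L : Y → A → ℝ) (P : Measure (X × Y)) (h : X → A) : ℝ :=
  ∫ z, L z.2 (h z.1) ∂P

/-- The joint distribution of features and labels whose feature marginal is the mixture of the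
marginals `PX i` with weights `w i`, and whose conditional label distribution is `κ`. -/
noncomputable def mixture {d : ℕ} (w : Fin d → ℝ) (PX : Fin d → Measure X) (κ : Kernel X Y) :
    Measure (X × Y) :=
  (∑ i, ENNReal.ofReal (w i) • PX i) ⊗ₘ κ

/-- Samples from all the domains: `k i` feature-label pairs from domain `i`. -/
abbrev Samples (X Y : Type*) {d : ℕ} (k : Fin d → ℕ) : Type _ :=
  (i : Fin d) → Fin (k i) → X × Y

/-- The law of the samples: all pairs are independent, those of domain `i` are distributed
according to `P_i`, with feature marginal `PX i` and conditional label distribution `κ`. -/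
noncomputable def sampleLaw {d : ℕ} (k : Fin d → ℕ) (PX : Fin d → Measure X) (κ : Kernel X Y) :
    Measure (Samples X Y k) :=
  Measure.pi fun i => Measure.pi fun _ : Fin (k i) => PX i ⊗ₘ κ

end Hypotheses

end DomainMixture

open DomainMixture

/-! The target risk is the `π'`-average of the source risks, so it suffices to bound each domain's
risk and take a union bound.

In (a), domain by domain, the risk of the aggregate exceeds its empirical risk on the second sample
by a VC term; that is at most the expert's empirical risk there; this exceeds the expert's risk by a
Hoeffding term, the expert being independent of the second sample; and the expert's risk exceeds its
training risk by a VC term. These three deviations give `3d` bad events. In (b) one VC deviation per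
domain suffices, with everything outside that domain frozen.

All deviations come from `measure_vc_deviation_le`, stated for one measurable data-dependent choice
`G D` in the class. No supremum over the class is formed, so none has to be measurable. Its proof is
an exponential symmetrization: Jensen introduces a ghost sample, random exchanges of paired points
give Rademacher signs, and a finite cover of the class on the `2k` points replaces the selected
function by a sum over the cover. Sauer-Shelah for subgraphs, tested on a grid of levels, makes this
cover polynomial in `k`.

Passing from `n_i = π_i n` to `n` costs `1 / √π_i` (`sqrt_rate_le`), whence the dependence of the
constant on `π`. -/

/-! ### Sauer-Shelah and uniform covers of classes of real functions -/

/-- Termwise in the binomial expansion: `n.choose k ≤ n ^ k ≤ n ^ k * v.choose k` for `k ≤ v`. -/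
theorem sum_choose_le_succ_pow (n v : ℕ) : ∑ k ∈ Finset.Iic v, n.choose k ≤ (n + 1) ^ v := by
  have h : Finset.Iic v = Finset.range (v + 1) := by ext; simp
  rw [h, add_pow]
  refine Finset.sum_le_sum fun k hk => ?_
  have hk' : k ≤ v := by simpa [Nat.lt_succ_iff] using hk
  simpa using Nat.mul_le_mul (Nat.choose_le_pow n k) (Nat.choose_pos hk')

/-- The **Sauer-Shelah lemma** for a family of sets: its traces on a finite set `S` are represented
by at most `(#S + 1) ^ v` members. -/
theorem exists_finset_trace_representatives {V : Type*} {𝒞 : Set (Set V)} {v : ℕ}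
    (h : vcDim 𝒞 ≤ v) (S : Finset V) :
    ∃ R : Finset (Set V), (R : Set (Set V)) ⊆ 𝒞 ∧ R.card ≤ (S.card + 1) ^ v ∧
      ∀ u ∈ 𝒞, ∃ r ∈ R, ∀ p ∈ S, p ∈ u ↔ p ∈ r := by
  classical
  let tr : Set V → Finset S := fun u => Finset.univ.filter fun p => p.1 ∈ u
  let 𝒜 : Finset (Finset S) := (Set.toFinite (tr '' 𝒞)).toFinset
  have hmem : ∀ a, a ∈ 𝒜 ↔ ∃ u ∈ 𝒞, tr u = a := fun a => by simp [𝒜]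
  -- Traces are taken in the subtype `S`, where the finite `Finset.vcDim` applies; a set shattered
  -- there maps to one shattered by `𝒞`.
  have hdim : 𝒜.vcDim ≤ v := by
    refine Finset.sup_le fun s hs => ?_
    rw [Finset.mem_shatterer] at hs
    have hsh : Shatters 𝒞 (s.map (Function.Embedding.subtype _)) := by
      intro t ht
      obtain ⟨a, ha, hat⟩ := hs (t := s.filter fun p => p.1 ∈ t) (Finset.filter_subset _ _)
      obtain ⟨u, hu, rfl⟩ := (hmem a).1 ha
      refine ⟨u, hu, fun z hz => ?_⟩
      obtain ⟨p, hp, rfl⟩ := Finset.mem_map.1 hz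
      have := Finset.ext_iff.1 hat p
      simpa [hp, tr] using this
    have h1 : ((s.map (Function.Embedding.subtype _)).card : ℕ∞) ≤ vcDim 𝒞 :=
      le_iSup₂_of_le _ hsh le_rfl
    rw [Finset.card_map] at h1
    exact_mod_cast h1.trans h
  have hcard : 𝒜.card ≤ (S.card + 1) ^ v :=
    calc 𝒜.card ≤ 𝒜.shatterer.card := 𝒜.card_le_card_shatterer
      _ ≤ ∑ k ∈ Finset.Iic 𝒜.vcDim, (Fintype.card S).choose k :=
        Finset.card_shatterer_le_sum_vcDim
      _ ≤ (Fintype.card S + 1) ^ 𝒜.vcDim := sum_choose_le_succ_pow _ _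
      _ ≤ (S.card + 1) ^ v := by
        rw [Fintype.card_coe]
        exact Nat.pow_le_pow_right (Nat.succ_pos _) hdim
  choose! rep hrep htr using fun a => (hmem a).1
  refine ⟨𝒜.image rep, ?_, Finset.card_image_le.trans hcard, fun u hu => ?_⟩
  · intro r hr
    obtain ⟨a, ha, rfl⟩ := Finset.mem_image.1 (Finset.mem_coe.1 hr)
    exact hrep a ha
  · have hu' : tr u ∈ 𝒜 := (hmem _).2 ⟨u, hu, rfl⟩
    refine ⟨rep (tr u), Finset.mem_image_of_mem _ hu', fun p hp => ?_⟩
    have := Finset.ext_iff.1 (htr _ hu') ⟨p, hp⟩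
    simpa [tr] using this.symm

/-- The subgraph of a real function. -/
def subgraph {Z : Type*} (g : Z → ℝ) : Set (Z × ℝ) := {p | p.2 < g p.1}

theorem subgraph_injective {Z : Type*} : Function.Injective (subgraph : (Z → ℝ) → Set (Z × ℝ)) := by
  intro f g h
  funext z
  have key : ∀ β : ℝ, β < f z ↔ β < g z := fun β => by
    have := Set.ext_iff.1 h (z, β)
    simpa [subgraph] using this
  exact le_antisymm (not_lt.1 fun h => lt_irrefl _ ((key _).1 h))
    (not_lt.1 fun h => lt_irrefl _ ((key _).2 h))

/-- A level of an `M`-point grid of `[-c, c]` separates any two values in `[-c, c]` that are more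
than `2 * c / M` apart. -/
theorem exists_grid_between {c a b : ℝ} {M : ℕ} (hM : 0 < M) (ha : -c ≤ a) (hb : b ≤ c)
    (hab : a + 2 * c / M < b) : ∃ l < M, a ≤ -c + l * (2 * c / M) ∧ -c + l * (2 * c / M) < b := by
  have hM' : (0 : ℝ) < M := by exact_mod_cast hM
  -- For `c < 0` the gap hypothesis is contradictory: `b - a ≤ 2c = M * (2c / M) ≤ 2c / M`.
  have hc : 0 ≤ c := by
    by_contra hc
    have h1 : M * (2 * c / M) = 2 * c := by field_simp
    have h2 : (1 : ℝ) ≤ M := by exact_mod_cast hM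
    have h3 : 2 * c / M < 0 := div_neg_of_neg_of_pos (by linarith) hM'
    nlinarith
  have hc' : 0 < c := by
    rcases hc.eq_or_lt with rfl | h
    · simp at hab; linarith
    · exact h
  set η := 2 * c / M with hη
  have hη0 : 0 < η := by positivity
  have hMη : M * η = 2 * c := by rw [hη]; field_simp
  have h1 : a + c ≤ ⌈(a + c) / η⌉₊ * η := (div_le_iff₀ hη0).1 (Nat.le_ceil _)
  have h2 : ⌈(a + c) / η⌉₊ * η < a + c + η := by
    have := Nat.ceil_lt_add_one (a := (a + c) / η) (div_nonneg (by linarith) hη0.le)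
    calc _ < ((a + c) / η + 1) * η := by gcongr
      _ = _ := by field_simp
  -- The first grid level at or above `a` lies below `a + η < b`; its index is less than `M` because
  -- level `M` is `c ≥ b`.
  refine ⟨⌈(a + c) / η⌉₊, ?_, by linarith, by linarith⟩
  have : (⌈(a + c) / η⌉₊ : ℝ) * η < M * η := by linarith
  exact_mod_cast lt_of_mul_lt_mul_right this hη0.le

/-- A uniformly bounded class of functions of pseudo-dimension `v` is covered, uniformly on finitely
many points, by polynomially many of its members. -/
theorem exists_finset_uniform_cover {Z ι : Type*} [Fintype ι] {𝒢 : Set (Z → ℝ)} {v M : ℕ} {c : ℝ}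
    (hVC : vcDim (subgraph '' 𝒢) ≤ v) (hc : ∀ g ∈ 𝒢, ∀ z, |g z| ≤ c) (hM : 0 < M) (z : ι → Z) :
    ∃ R : Finset (Z → ℝ), (R : Set (Z → ℝ)) ⊆ 𝒢 ∧ R.card ≤ (Fintype.card ι * M + 1) ^ v ∧
      ∀ g ∈ 𝒢, ∃ r ∈ R, ∀ j, |g (z j) - r (z j)| ≤ 2 * c / M := by
  classical
  -- The trace of a subgraph on `S` records which grid levels lie below the value at each `z j`, so
  -- equal traces force values within one grid step.
  let S : Finset (Z × ℝ) := Finset.image (fun q : ι × ℕ => (z q.1, -c + q.2 * (2 * c / M)))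
    (Finset.univ ×ˢ Finset.range M)
  have hS : S.card ≤ Fintype.card ι * M := by
    refine Finset.card_image_le.trans ?_
    simp
  obtain ⟨R, hR, hRc, hcov⟩ := exists_finset_trace_representatives hVC S
  have hR' : ∀ r ∈ R, ∃ g ∈ 𝒢, subgraph g = r := fun r hr => hR (Finset.mem_coe.2 hr)
  choose! rep hrep hsub using hR'
  refine ⟨R.image rep, ?_, ?_, fun g hg => ?_⟩
  · intro r hr
    obtain ⟨a, ha, rfl⟩ := Finset.mem_image.1 (Finset.mem_coe.1 hr)
    exact hrep a ha
  · exact Finset.card_image_le.trans (hRc.trans (Nat.pow_le_pow_left (by omega) _))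
  · obtain ⟨r, hr, htr⟩ := hcov _ ⟨g, hg, rfl⟩
    refine ⟨rep r, Finset.mem_image_of_mem _ hr, fun j => ?_⟩
    have key : ∀ l < M, -c + l * (2 * c / M) < g (z j) ↔ -c + l * (2 * c / M) < rep r (z j) := by
      intro l hl
      have := htr (z j, -c + l * (2 * c / M)) (Finset.mem_image.2 ⟨(j, l), by simp [hl], rfl⟩)
      rw [← hsub r hr] at this
      simpa [subgraph] using this
    have hg' := abs_le.1 (hc g hg (z j))
    have hr' := abs_le.1 (hc _ (hrep r hr) (z j))
    rw [abs_le]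
    constructor
    · by_contra hlt
      obtain ⟨l, hl, h1, h2⟩ := exists_grid_between (a := g (z j)) (b := rep r (z j)) hM hg'.1 hr'.2
        (by linarith)
      exact absurd ((key l hl).2 h2) (not_lt.2 h1)
    · by_contra hlt
      obtain ⟨l, hl, h1, h2⟩ := exists_grid_between (a := rep r (z j)) (b := g (z j)) hM hr'.1 hg'.2
        (by linarith)
      exact absurd ((key l hl).1 h2) (not_lt.2 h1)

/-- On a one-point set, `2 ^ 0 = 1` representative suffices, so all subgraphs agree at every point.
Dimension zero needs this exact statement: its rate has no `log k` to absorb a covering number. -/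
theorem subsingleton_of_vcDim_subgraph_le_zero {Z : Type*} {𝒢 : Set (Z → ℝ)}
    (h : vcDim (subgraph '' 𝒢) ≤ 0) : 𝒢.Subsingleton := by
  intro f hf g hg
  have := exists_finset_trace_representatives (v := 0) (by simpa using h)
  refine subgraph_injective (Set.ext fun p => ?_)
  obtain ⟨R, -, hR, hcov⟩ := this {p}
  obtain ⟨r, hr, h1⟩ := hcov _ ⟨f, hf, rfl⟩
  obtain ⟨s, hs, h2⟩ := hcov _ ⟨g, hg, rfl⟩
  have hrs : r = s := Finset.card_le_one.1 (by simpa using hR) r hr s hs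
  subst hrs
  rw [h1 p (by simp), h2 p (by simp)]

theorem vcDim_singleton_le_zero {V : Type*} (u : Set V) : vcDim {u} ≤ 0 := by
  refine iSup₂_le fun s hs => ?_
  rcases s.eq_empty_or_nonempty with rfl | ⟨p, hp⟩
  · simp
  · obtain ⟨_, rfl, h1⟩ := hs ∅ (by simp)
    obtain ⟨_, rfl, h2⟩ := hs s subset_rfl
    simpa [hp, h1 p hp] using h2 p hp

/-! ### Rademacher averages over a finite cover -/

/-- The moment generating function of a Rademacher sum is sub-Gaussian. -/
theorem sum_exp_sign_le {ι : Type*} [Fintype ι] [DecidableEq ι] (x : ι → ℝ) :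
    ∑ σ : ι → Bool, Real.exp (∑ j, if σ j then x j else -x j) ≤
      2 ^ Fintype.card ι * Real.exp (∑ j, x j ^ 2 / 2) := by
  have h1 : ∑ σ : ι → Bool, Real.exp (∑ j, if σ j then x j else -x j) =
      ∏ j, ∑ b : Bool, Real.exp (if b then x j else -x j) := by
    rw [Finset.prod_univ_sum, Fintype.piFinset_univ]
    exact Finset.sum_congr rfl fun σ _ => Real.exp_sum _ _
  have h2 : (2 : ℝ) ^ Fintype.card ι * Real.exp (∑ j, x j ^ 2 / 2) =
      ∏ j, (2 * Real.exp (x j ^ 2 / 2)) := by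
    rw [Finset.prod_mul_distrib, Real.exp_sum]; simp
  rw [h1, h2]
  refine Finset.prod_le_prod (fun j _ => Finset.sum_nonneg fun b _ => (Real.exp_pos _).le)
    fun j _ => ?_
  have := Real.cosh_le_exp_half_sq (x j)
  rw [Real.cosh_eq] at this
  simp
  linarith

/-- The average over all exchanges of paired points of an exponential moment, for a function that is
selected from a class after the exchange. -/
theorem sum_exp_swap_le {Z ι : Type*} [Fintype ι] [DecidableEq ι] {𝒢 : Set (Z → ℝ)} {c η s : ℝ}
    {R : Finset (Z → ℝ)} (hc : ∀ g ∈ 𝒢, ∀ z, |g z| ≤ c) (hs : 0 ≤ s) (hR : (R : Set (Z → ℝ)) ⊆ 𝒢)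
    (a b : ι → Z) (hcov : ∀ g ∈ 𝒢, ∃ r ∈ R, ∀ j, |g (a j) - r (a j)| ≤ η ∧ |g (b j) - r (b j)| ≤ η)
    (h : (ι → Bool) → Z → ℝ) (hh : ∀ σ, h σ ∈ 𝒢) :
    ∑ σ : ι → Bool, Real.exp (s * ∑ j, (if σ j then h σ (b j) - h σ (a j)
        else h σ (a j) - h σ (b j))) ≤
      2 ^ Fintype.card ι * (R.card * Real.exp (2 * s * Fintype.card ι * η +
        2 * Fintype.card ι * s ^ 2 * c ^ 2)) := by
  have step : ∀ σ : ι → Bool, Real.exp (s * ∑ j, (if σ j then h σ (b j) - h σ (a j)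
        else h σ (a j) - h σ (b j))) ≤ Real.exp (2 * s * Fintype.card ι * η) *
      ∑ r ∈ R, Real.exp (∑ j, if σ j then s * (r (b j) - r (a j)) else -(s * (r (b j) - r (a j))))
      := by
    intro σ
    -- The selected function varies with `σ`, so it is replaced by a nearby `r`, and its exponential
    -- by the sum over all of `R`. Each pair costs `2 * η`.
    obtain ⟨r, hr, hclose⟩ := hcov _ (hh σ)
    refine le_trans ?_ (mul_le_mul_of_nonneg_left (Finset.single_le_sum
      (f := fun r : Z → ℝ => Real.exp (∑ j, if σ j then s * (r (b j) - r (a j))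
        else -(s * (r (b j) - r (a j))))) (fun _ _ => (Real.exp_pos _).le) hr)
      (Real.exp_pos _).le)
    rw [← Real.exp_add, Real.exp_le_exp]
    have hconst : 2 * s * Fintype.card ι * η = ∑ _j : ι, 2 * s * η := by simp; ring
    rw [hconst, ← Finset.sum_add_distrib, Finset.mul_sum]
    refine Finset.sum_le_sum fun j _ => ?_
    obtain ⟨h1, h2⟩ := hclose j
    rw [abs_le] at h1 h2
    split_ifs
    · nlinarith
    · nlinarith
  refine (Finset.sum_le_sum fun σ _ => step σ).trans ?_
  rw [← Finset.mul_sum, Finset.sum_comm, Real.exp_add]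
  have hr : ∀ r ∈ R, ∑ σ : ι → Bool, Real.exp (∑ j, if σ j then s * (r (b j) - r (a j))
      else -(s * (r (b j) - r (a j)))) ≤
      2 ^ Fintype.card ι * Real.exp (2 * Fintype.card ι * s ^ 2 * c ^ 2) := by
    intro r hr
    refine (sum_exp_sign_le _).trans ?_
    gcongr
    have hconst : 2 * Fintype.card ι * s ^ 2 * c ^ 2 = ∑ _j : ι, 2 * s ^ 2 * c ^ 2 := by
      simp; ring
    rw [hconst]
    refine Finset.sum_le_sum fun j _ => ?_
    have h1 := abs_le.1 (hc r (hR hr) (a j))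
    have h2 := abs_le.1 (hc r (hR hr) (b j))
    -- Hence each squared coefficient, halved, is at most `2 * s ^ 2 * c ^ 2`.
    have h3 : (r (b j) - r (a j)) ^ 2 ≤ (2 * c) ^ 2 := sq_le_sq' (by linarith) (by linarith)
    nlinarith [mul_le_mul_of_nonneg_left h3 (sq_nonneg s)]
  calc _ ≤ Real.exp (2 * s * Fintype.card ι * η) * ∑ _r ∈ R,
        2 ^ Fintype.card ι * Real.exp (2 * Fintype.card ι * s ^ 2 * c ^ 2) := by
        gcongr with r hrR
        exact hr r hrR
    _ = _ := by rw [Finset.sum_const, nsmul_eq_mul]; ring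

/-! ### Symmetrization with a ghost sample -/

section Symmetrization

variable {Z ι : Type*} [MeasurableSpace Z] [Fintype ι]

/-- Exchanging the entries of the pairs selected by `σ` preserves the law of independent pairs of
identically distributed points. -/
theorem measurePreserving_swap_pairs (μ : Measure Z) [IsProbabilityMeasure μ] (σ : ι → Bool) :
    MeasurePreserving (fun (W : ι → Z × Z) j => if σ j then W j else (W j).swap)
      (Measure.pi fun _ => μ.prod μ) (Measure.pi fun _ => μ.prod μ) := by
  refine measurePreserving_pi (fun _ => μ.prod μ) (fun _ => μ.prod μ)
    (f := fun j w => if σ j then w else w.swap) fun j => ?_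
  cases σ j
  · simpa using Measure.measurePreserving_swap
  · simpa using! MeasurePreserving.id (μ.prod μ)

/-- Exchanges preserve the law, so the integral equals that of the average over all exchanges. For
fixed pairs this average is a Rademacher average, bounded pointwise by `sum_exp_swap_le`. -/
theorem integral_exp_ghost_le [DecidableEq ι] {μ : Measure Z} [IsProbabilityMeasure μ]
    {𝒢 : Set (Z → ℝ)} {K c η s : ℝ} (hc : ∀ g ∈ 𝒢, ∀ z, |g z| ≤ c) (hs : 0 ≤ s)
    (hcov : ∀ z : ι × Bool → Z, ∃ R : Finset (Z → ℝ), (R : Set (Z → ℝ)) ⊆ 𝒢 ∧ (R.card : ℝ) ≤ K ∧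
      ∀ g ∈ 𝒢, ∃ r ∈ R, ∀ j, |g (z j) - r (z j)| ≤ η)
    {G : (ι → Z) → Z → ℝ} (hG : ∀ D, G D ∈ 𝒢)
    (hint : Integrable (fun W : ι → Z × Z => Real.exp (s * ∑ j,
      (G (fun i => (W i).1) (W j).2 - G (fun i => (W i).1) (W j).1)))
      (Measure.pi fun _ => μ.prod μ)) :
    ∫ W : ι → Z × Z, Real.exp (s * ∑ j, (G (fun i => (W i).1) (W j).2
        - G (fun i => (W i).1) (W j).1)) ∂(Measure.pi fun _ => μ.prod μ) ≤
      K * Real.exp (2 * s * Fintype.card ι * η + 2 * Fintype.card ι * s ^ 2 * c ^ 2) := by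
  set P : Measure (ι → Z × Z) := Measure.pi fun _ => μ.prod μ
  set Ψ : (ι → Z × Z) → ℝ := fun W => Real.exp (s * ∑ j,
      (G (fun i => (W i).1) (W j).2 - G (fun i => (W i).1) (W j).1)) with hΨ
  let sw : (ι → Bool) → (ι → Z × Z) → (ι → Z × Z) := fun σ W j =>
    if σ j then W j else (W j).swap
  have hsw : ∀ σ, MeasurePreserving (sw σ) P P := fun σ => measurePreserving_swap_pairs μ σ
  have hinv : ∀ σ, ∫ W, Ψ (sw σ W) ∂P = ∫ W, Ψ W ∂P := by
    intro σ
    have h := integral_map (hsw σ).measurable.aemeasurable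
      (show AEStronglyMeasurable Ψ (P.map (sw σ)) by
        rw [(hsw σ).map_eq]; exact hint.aestronglyMeasurable)
    rw [← h, (hsw σ).map_eq]
  have hpt : ∀ W, ∑ σ, Ψ (sw σ W) ≤ 2 ^ Fintype.card ι * (K *
      Real.exp (2 * s * Fintype.card ι * η + 2 * Fintype.card ι * s ^ 2 * c ^ 2)) := by
    intro W
    -- The cover is chosen on both members of every pair, so the same `R` serves all exchanges `σ`.
    obtain ⟨R, hR, hRK, hRc⟩ := hcov fun q => if q.2 then (W q.1).2 else (W q.1).1
    have := sum_exp_swap_le (ι := ι) (η := η) hc hs hR (fun j => (W j).1) (fun j => (W j).2)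
      (fun g hg => by
        obtain ⟨r, hr, h⟩ := hRc g hg
        exact ⟨r, hr, fun j => ⟨by simpa using h (j, false), by simpa using h (j, true)⟩⟩)
      (fun σ => G fun i => (sw σ W i).1) (fun σ => hG _)
    refine le_trans (le_of_eq ?_) (this.trans ?_)
    · refine Finset.sum_congr rfl fun σ _ => ?_
      simp only [hΨ]
      congr 2
      refine Finset.sum_congr rfl fun j _ => ?_
      have : sw σ W j = if σ j then W j else (W j).swap := rfl
      rw [this]
      split_ifs <;> simp
    · gcongr
  have hsum : (2 : ℝ) ^ Fintype.card ι * ∫ W, Ψ W ∂P = ∫ W, ∑ σ, Ψ (sw σ W) ∂P := by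
    rw [integral_finsetSum]
    · simp [hinv]
    · exact fun σ _ => (hsw σ).integrable_comp_of_integrable hint
  have hle : ∫ W, ∑ σ, Ψ (sw σ W) ∂P ≤ 2 ^ Fintype.card ι * (K *
      Real.exp (2 * s * Fintype.card ι * η + 2 * Fintype.card ι * s ^ 2 * c ^ 2)) := by
    refine (integral_mono (integrable_finsetSum _
      fun σ _ => (hsw σ).integrable_comp_of_integrable hint) (integrable_const _) hpt).trans ?_
    simp [P]
  rw [← hsum] at hle
  exact le_of_mul_le_mul_left hle (by positivity)

/-- One-sided deviation of the empirical mean of a data-dependent member of a class of functions with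
finite uniform covers. -/
theorem measure_deviation_le_of_cover [DecidableEq ι] {μ : Measure Z} [IsProbabilityMeasure μ]
    {𝒢 : Set (Z → ℝ)} {K c η s : ℝ} (hc : ∀ g ∈ 𝒢, ∀ z, |g z| ≤ c) (hs : 0 ≤ s)
    (hcov : ∀ z : ι × Bool → Z, ∃ R : Finset (Z → ℝ), (R : Set (Z → ℝ)) ⊆ 𝒢 ∧ (R.card : ℝ) ≤ K ∧
      ∀ g ∈ 𝒢, ∃ r ∈ R, ∀ j, |g (z j) - r (z j)| ≤ η)
    {G : (ι → Z) → Z → ℝ} (hG : ∀ D, G D ∈ 𝒢)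
    (hmeas : Measurable fun p : (ι → Z) × Z => G p.1 p.2) (t : ℝ) :
    (Measure.pi fun _ : ι => μ).real
        {D | t < Fintype.card ι * ∫ z, G D z ∂μ - ∑ j, G D (D j)} ≤
      K * Real.exp (2 * s * Fintype.card ι * η + 2 * Fintype.card ι * s ^ 2 * c ^ 2 - s * t) := by
  set Q : Measure (ι → Z) := Measure.pi fun _ : ι => μ
  set Φ : (ι → Z) → (ι → Z) → ℝ := fun D D' => Real.exp (s * ∑ j, (G D (D' j) - G D (D j)))
  set B : ℝ := Real.exp (s * ∑ _j : ι, (c + c)) with hB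
  have hΦm : Measurable fun p : (ι → Z) × (ι → Z) => Φ p.1 p.2 := by
    refine Real.measurable_exp.comp (measurable_const.mul (Finset.measurable_sum _ fun j _ => ?_))
    exact (hmeas.comp (measurable_fst.prodMk ((measurable_pi_apply j).comp measurable_snd))).sub
      (hmeas.comp (measurable_fst.prodMk ((measurable_pi_apply j).comp measurable_fst)))
  have hΦB : ∀ D D', ‖Φ D D'‖ ≤ B := by
    intro D D'
    rw [Real.norm_eq_abs, abs_of_pos (Real.exp_pos _), hB, Real.exp_le_exp]
    gcongr with j
    have h1 := abs_le.1 (hc _ (hG D) (D j))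
    have h2 := abs_le.1 (hc _ (hG D) (D' j))
    linarith
  have hΦi : Integrable (fun p : (ι → Z) × (ι → Z) => Φ p.1 p.2) (Q.prod Q) :=
    Integrable.of_bound hΦm.aestronglyMeasurable B (Filter.Eventually.of_forall fun p => hΦB _ _)
  have hGm : ∀ D, Measurable (G D) := fun D => hmeas.comp (measurable_const.prodMk measurable_id)
  have hGi : ∀ D, Integrable (G D) μ := fun D =>
    Integrable.of_bound (hGm D).aestronglyMeasurable c
      (Filter.Eventually.of_forall fun z => hc _ (hG D) z)
  -- the ghost sample
  have hjensen : ∀ D, Real.exp (s * (Fintype.card ι * ∫ z, G D z ∂μ - ∑ j, G D (D j))) ≤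
      ∫ D', Φ D D' ∂Q := by
    intro D
    have hev : ∀ j : ι, Integrable (fun D' : ι → Z => G D (D' j)) Q := fun j =>
      (measurePreserving_eval (fun _ : ι => μ) j).integrable_comp_of_integrable (hGi D)
    have hint : ∀ j : ι, ∫ D', G D (D' j) ∂Q = ∫ z, G D z ∂μ := by
      intro j
      have hmp := measurePreserving_eval (fun _ : ι => μ) j
      rw [← hmp.map_eq, integral_map hmp.measurable.aemeasurable (hGm D).aestronglyMeasurable]
    have hmean : ∫ D', s * ∑ j, (G D (D' j) - G D (D j)) ∂Q =
        s * (Fintype.card ι * ∫ z, G D z ∂μ - ∑ j, G D (D j)) := by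
      rw [integral_const_mul]
      simp_rw [Finset.sum_sub_distrib]
      rw [integral_sub (integrable_finsetSum _ fun j _ => hev j) (integrable_const _),
        integral_finsetSum _ fun j _ => hev j]
      simp [hint, Q]
    rw [← hmean]
    refine ConvexOn.map_integral_le (s := Set.univ) convexOn_exp Real.continuous_exp.continuousOn
      isClosed_univ (by simp) ?_ ?_
    · exact (integrable_finsetSum _ fun j _ => (hev j).sub (integrable_const _)).const_mul s
    · exact Integrable.of_bound (hΦm.comp (measurable_const.prodMk
        measurable_id)).aestronglyMeasurable B (Filter.Eventually.of_forall fun D' => hΦB D D')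
  -- exchanging the sample and its ghost
  have hmp := measurePreserving_arrowProdEquivProdArrow Z Z ι (fun _ => μ) (fun _ => μ)
  have htr : ∫ p, Φ p.1 p.2 ∂(Q.prod Q) = ∫ W : ι → Z × Z, Real.exp (s * ∑ j,
      (G (fun i => (W i).1) (W j).2 - G (fun i => (W i).1) (W j).1))
      ∂(Measure.pi fun _ => μ.prod μ) := by
    rw [← hmp.integral_comp' (f := MeasurableEquiv.arrowProdEquivProdArrow Z Z ι)]
    rfl
  have hmgf := integral_exp_ghost_le (μ := μ) (η := η) hc hs hcov hG
    (hmp.integrable_comp_of_integrable hΦi)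
  rw [← htr, integral_prod _ hΦi] at hmgf
  -- Chernoff's method: Markov's inequality for the ghost average, which dominates the exponential
  -- of the deviation.
  have hmarkov := mul_meas_ge_le_integral_of_nonneg (μ := Q) (f := fun D => ∫ D', Φ D D' ∂Q)
    (Filter.Eventually.of_forall fun D => integral_nonneg fun D' => (Real.exp_pos _).le)
    hΦi.integral_prod_left (Real.exp (s * t))
  have hsub : {D | t < Fintype.card ι * ∫ z, G D z ∂μ - ∑ j, G D (D j)} ⊆
      {D | Real.exp (s * t) ≤ ∫ D', Φ D D' ∂Q} := by
    intro D hD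
    refine le_trans (Real.exp_le_exp.2 ?_) (hjensen D)
    exact mul_le_mul_of_nonneg_left (le_of_lt hD) hs
  refine (measureReal_mono hsub).trans ?_
  rw [Real.exp_sub, ← mul_div_assoc, le_div_iff₀ (Real.exp_pos _), mul_comm]
  exact hmarkov.trans hmgf

end Symmetrization

/-! ### The VC deviation inequality -/

/-- The constant of the deviation bound for classes of functions bounded by `c`. -/
def deviationConst (c : ℝ) : ℝ := 5 + 4 * c + 2 * c ^ 2

/-- The exponential bound is used with `s` equal to the rate `r` itself and with a grid of `M = k`
levels. At `k = 1` the term `v * log k` vanishes and cannot pay for the cover; there `log (1 / δ) ≥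
1` makes the claimed bound exceed the trivial `2 * c`. -/
theorem measure_vc_deviation_le {Z : Type*} [MeasurableSpace Z] {k v : ℕ} {μ : Measure Z}
    [IsProbabilityMeasure μ] {𝒢 : Set (Z → ℝ)} {c δ : ℝ} (hc0 : 0 ≤ c)
    (hc : ∀ g ∈ 𝒢, ∀ z, |g z| ≤ c) (hVC : vcDim (subgraph '' 𝒢) ≤ v)
    {G : (Fin k → Z) → Z → ℝ} (hG : ∀ D, G D ∈ 𝒢)
    (hmeas : Measurable fun p : (Fin k → Z) × Z => G p.1 p.2) (hδ : 0 < δ) (hδ1 : δ < 1)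
    (hk : 2 ≤ k ∨ k = 1 ∧ 1 ≤ Real.log (1 / δ)) :
    (Measure.pi fun _ : Fin k => μ).real
      {D | deviationConst c * √((v * Real.log k + Real.log (1 / δ)) / k) <
        ∫ z, G D z ∂μ - (k : ℝ)⁻¹ * ∑ j, G D (D j)} ≤ δ := by
  have hk1 : 1 ≤ k := by omega
  have hkR : (1 : ℝ) ≤ k := by exact_mod_cast hk1
  have hkpos : (0 : ℝ) < k := by linarith
  set ℓ := Real.log (1 / δ) with hℓ
  have hℓ0 : 0 < ℓ := Real.log_pos (by rw [lt_div_iff₀ hδ]; linarith)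
  have hexpℓ : Real.exp (-ℓ) = δ := by
    rw [hℓ, one_div, Real.log_inv, neg_neg, Real.exp_log hδ]
  have hlogk : 0 ≤ Real.log k := Real.log_nonneg hkR
  have hvlog : 0 ≤ v * Real.log k := by positivity
  set L₀ := v * Real.log k + ℓ with hL₀
  have hL₀pos : 0 < L₀ := by positivity
  set r := √(L₀ / k) with hr
  have hr0 : 0 ≤ r := Real.sqrt_nonneg _
  have hr2 : k * r ^ 2 = L₀ := by
    rw [hr, Real.sq_sqrt (by positivity)]; field_simp
  have hC : 0 < deviationConst c := by unfold deviationConst; positivity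
  have hset : {D : Fin k → Z | deviationConst c * r <
        ∫ z, G D z ∂μ - (k : ℝ)⁻¹ * ∑ j, G D (D j)} =
      {D | k * (deviationConst c * r) <
        Fintype.card (Fin k) * ∫ z, G D z ∂μ - ∑ j, G D (D j)} := by
    ext D
    simp only [Set.mem_ofPred_eq, Fintype.card_fin]
    have : (k : ℝ) * ∫ z, G D z ∂μ - ∑ j, G D (D j) =
        k * (∫ z, G D z ∂μ - (k : ℝ)⁻¹ * ∑ j, G D (D j)) := by field_simp
    rw [this, mul_lt_mul_iff_right₀ hkpos]
  rw [hset]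
  rcases Nat.eq_zero_or_pos v with rfl | hv
  · have hss := subsingleton_of_vcDim_subgraph_le_zero (by simpa using hVC)
    have hcov : ∀ z : Fin k × Bool → Z, ∃ R : Finset (Z → ℝ), (R : Set (Z → ℝ)) ⊆ 𝒢 ∧
        (R.card : ℝ) ≤ 1 ∧ ∀ g ∈ 𝒢, ∃ r ∈ R, ∀ j, |g (z j) - r (z j)| ≤ 0 := by
      intro z
      rcases 𝒢.eq_empty_or_nonempty with h | ⟨g₀, hg₀⟩
      · exact ⟨∅, by simp, by simp, by simp [h]⟩
      · exact ⟨{g₀}, by simpa using hg₀, by simp, fun g hg =>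
          ⟨g₀, by simp, fun j => by simp [hss hg hg₀]⟩⟩
    refine (measure_deviation_le_of_cover hc hr0 hcov hG hmeas _).trans ?_
    rw [one_mul, ← hexpℓ, Real.exp_le_exp, Fintype.card_fin]
    have hLℓ : L₀ = ℓ := by simp [hL₀]
    have e : 2 * r * k * 0 + 2 * k * r ^ 2 * c ^ 2 - r * (k * (deviationConst c * r)) =
        (2 * c ^ 2 - deviationConst c) * (k * r ^ 2) := by ring
    rw [e, hr2, hLℓ, deviationConst]
    nlinarith
  rcases hk with hk2 | ⟨rfl, hl⟩
  · have hk2R : (2 : ℝ) ≤ k := by exact_mod_cast hk2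
    have hcov : ∀ z : Fin k × Bool → Z, ∃ R : Finset (Z → ℝ), (R : Set (Z → ℝ)) ⊆ 𝒢 ∧
        (R.card : ℝ) ≤ (2 * k * k + 1) ^ v ∧
        ∀ g ∈ 𝒢, ∃ r ∈ R, ∀ j, |g (z j) - r (z j)| ≤ 2 * c / k := by
      intro z
      obtain ⟨R, hR, hcard, h⟩ := exists_finset_uniform_cover hVC hc hk1 z
      refine ⟨R, hR, ?_, h⟩
      have : R.card ≤ (2 * k * k + 1) ^ v := by simpa [mul_comm] using hcard
      exact_mod_cast this
    refine (measure_deviation_le_of_cover hc hr0 hcov hG hmeas _).trans ?_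
    have hcard : ((2 * k * k + 1 : ℝ)) ^ v ≤ Real.exp (4 * L₀) := by
      -- This needs `k ≥ 2`, and is the source of the `4 * L₀` in the exponent.
      have h1 : (2 * k * k + 1 : ℝ) ≤ (k : ℝ) ^ 4 := by
        have : (4 : ℝ) ≤ k ^ 2 := by nlinarith
        nlinarith
      have h2 : Real.exp (v * Real.log k) = (k : ℝ) ^ v := by
        rw [mul_comm, Real.exp_mul, Real.exp_log hkpos, Real.rpow_natCast]
      calc (2 * k * k + 1 : ℝ) ^ v ≤ ((k : ℝ) ^ 4) ^ v := by gcongr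
        _ = ((k : ℝ) ^ v) ^ 4 := by rw [← pow_mul, ← pow_mul, mul_comm]
        _ = Real.exp (4 * (v * Real.log k)) := by
          rw [← h2, ← Real.exp_nat_mul]; norm_num
        _ ≤ _ := Real.exp_le_exp.2 (by linarith)
    have hrL : r ≤ L₀ := by
      have hlog2 : 1 / 2 ≤ Real.log k :=
        le_trans (by linarith [Real.log_two_gt_d9]) (Real.log_le_log two_pos hk2R)
      have hv1 : (1 : ℝ) ≤ v := by exact_mod_cast hv
      have hL : 1 / 2 ≤ L₀ := by nlinarith
      rw [hr, Real.sqrt_le_left hL₀pos.le, div_le_iff₀ hkpos]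
      nlinarith [mul_pos hL₀pos hkpos]
    calc _ ≤ Real.exp (4 * L₀) * Real.exp (2 * r * Fintype.card (Fin k) * (2 * c / k) +
          2 * Fintype.card (Fin k) * r ^ 2 * c ^ 2 - r * (k * (deviationConst c * r))) := by
          gcongr
      _ ≤ δ := by
        rw [← Real.exp_add, ← hexpℓ, Real.exp_le_exp, Fintype.card_fin]
        -- The terms are the covering number, the grid error `4 * c * r ≤ 4 * c * L₀`, the variance
        -- `2 * c ^ 2 * L₀` and the gain. `deviationConst` is their coefficient sum plus one, which
        -- leaves `-L₀ ≤ -ℓ`.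
        have e : 4 * L₀ + (2 * r * k * (2 * c / k) + 2 * k * r ^ 2 * c ^ 2
            - r * (k * (deviationConst c * r))) =
            4 * L₀ + 4 * c * r + (2 * c ^ 2 - deviationConst c) * (k * r ^ 2) := by
          field_simp; ring
        rw [e, hr2, deviationConst]
        nlinarith [mul_le_mul_of_nonneg_left hrL hc0]
  · rw [← hset]
    have hempty : {D : Fin 1 → Z | deviationConst c * r <
        ∫ z, G D z ∂μ - ((1 : ℕ) : ℝ)⁻¹ * ∑ j, G D (D j)} = ∅ := by
      ext D
      simp only [Set.mem_ofPred_eq, Set.mem_empty_iff_false, iff_false, not_lt]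
      have h1 : |∫ z, G D z ∂μ| ≤ c := by
        have := norm_integral_le_of_norm_le_const (μ := μ) (f := G D) (C := c)
          (Filter.Eventually.of_forall fun z => hc _ (hG D) z)
        simpa using this
      have h2 := hc _ (hG D) (D 0)
      rw [abs_le] at h1 h2
      have hr1 : 1 ≤ r := by
        rw [hr, Real.one_le_sqrt]
        simp only [Nat.cast_one, div_one]
        linarith
      have h3 : 2 * c ≤ deviationConst c * r := by
        refine le_trans ?_ (mul_le_mul_of_nonneg_left hr1 hC.le)
        unfold deviationConst
        nlinarith [sq_nonneg c]
      simp
      linarith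
    rw [hempty]
    simp [hδ.le]

/-! ### Freezing coordinates of product measures -/

section Product

theorem measureReal_prod_le_of_forall {α β : Type*} [MeasurableSpace α] [MeasurableSpace β]
    {μ : Measure α} {ν : Measure β} [IsProbabilityMeasure μ] [IsProbabilityMeasure ν]
    {E : Set (α × β)} (hE : MeasurableSet E) {b : ℝ}
    (h : ∀ a, ν.real {x | (a, x) ∈ E} ≤ b) : (μ.prod ν).real E ≤ b := by
  have hb : 0 ≤ b := by
    obtain ⟨a⟩ : Nonempty α := μ.nonempty_of_neZero
    exact measureReal_nonneg.trans (h a)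
  refine ENNReal.toReal_le_of_le_ofReal hb ?_
  rw [Measure.prod_apply hE]
  calc ∫⁻ a, ν (Prod.mk a ⁻¹' E) ∂μ ≤ ∫⁻ _a, ENNReal.ofReal b ∂μ :=
        lintegral_mono fun a => (ENNReal.le_ofReal_iff_toReal_le (measure_ne_top _ _) hb).2 (h a)
    _ = ENNReal.ofReal b := by simp

variable {ι : Type*} [Fintype ι] [DecidableEq ι] {α β : ι → Type*} [∀ i, MeasurableSpace (α i)]
  [∀ i, MeasurableSpace (β i)]

/-- Resampling a coordinate preserves a product probability measure. -/
theorem measurePreserving_update_pi (ν : ∀ i, Measure (α i)) [∀ i, IsProbabilityMeasure (ν i)]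
    (i : ι) : MeasurePreserving (fun p : (∀ j, α j) × α i => Function.update p.1 i p.2)
      ((Measure.pi ν).prod (ν i)) (Measure.pi ν) := by
  have hm : Measurable fun p : (∀ j, α j) × α i => Function.update p.1 i p.2 :=
    measurable_update'
  refine ⟨hm, (Measure.pi_eq fun s hs => ?_).symm⟩
  have hpre : (fun p : (∀ j, α j) × α i => Function.update p.1 i p.2) ⁻¹' Set.univ.pi s =
      (Set.univ.pi (Function.update s i Set.univ)) ×ˢ s i := by
    ext p
    simp only [Set.mem_preimage, Set.mem_univ_pi, Set.mem_prod]
    constructor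
    · refine fun h => ⟨fun j => ?_, by simpa using h i⟩
      rcases eq_or_ne j i with rfl | hj
      · simp
      · simpa [hj] using h j
    · rintro ⟨h1, h2⟩ j
      rcases eq_or_ne j i with rfl | hj
      · simpa using h2
      · simpa [hj] using h1 j
  rw [Measure.map_apply hm (MeasurableSet.univ_pi hs), hpre, Measure.prod_prod, Measure.pi_pi,
    ← Finset.mul_prod_erase _ _ (Finset.mem_univ i), ← Finset.mul_prod_erase _ _ (Finset.mem_univ i)]
  rw [Function.update_self, measure_univ, one_mul, mul_comm]
  congr 1
  refine Finset.prod_congr rfl fun j hj => ?_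
  rw [Function.update_of_ne (Finset.ne_of_mem_erase hj)]

/-- Conditioning on all coordinates but `i`: resampling coordinate `i` leaves the law unchanged, and
Fubini integrates the bound over the frozen ones. -/
theorem measureReal_pi_le_of_update {ν : ∀ i, Measure (α i)} [∀ i, IsProbabilityMeasure (ν i)]
    (i : ι) {E : Set (∀ i, α i)} (hE : MeasurableSet E) {b : ℝ}
    (h : ∀ a, (ν i).real {x | Function.update a i x ∈ E} ≤ b) : (Measure.pi ν).real E ≤ b := by
  have hmp := measurePreserving_update_pi ν i
  rw [measureReal_def, ← hmp.measure_preimage hE.nullMeasurableSet, ← measureReal_def]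
  exact measureReal_prod_le_of_forall (hmp.measurable hE) h

/-- The same conditioning with coordinate `i` free in both factors, as needed for a predictor
learned from the union of the samples. -/
theorem measureReal_pi_prod_pi_le_of_update {ν : ∀ i, Measure (α i)} {ν' : ∀ i, Measure (β i)}
    [∀ i, IsProbabilityMeasure (ν i)] [∀ i, IsProbabilityMeasure (ν' i)] (i : ι)
    {E : Set ((∀ i, α i) × ∀ i, β i)} (hE : MeasurableSet E) {b : ℝ}
    (h : ∀ a a', ((ν i).prod (ν' i)).real
      {x | (Function.update a i x.1, Function.update a' i x.2) ∈ E} ≤ b) :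
    ((Measure.pi ν).prod (Measure.pi ν')).real E ≤ b := by
  have h1 := measurePreserving_update_pi ν i
  have h2 := measurePreserving_update_pi ν' i
  have hmp := h1.prod h2
  rw [measureReal_def, ← hmp.measure_preimage hE.nullMeasurableSet]
  have hm := hmp.measurable hE
  set E' := (Prod.map (fun p : (∀ j, α j) × α i => Function.update p.1 i p.2)
    fun p : (∀ j, β j) × β i => Function.update p.1 i p.2) ⁻¹' E with hE'
  have hb : 0 ≤ b := by
    obtain ⟨a⟩ : Nonempty (∀ i, α i) := (Measure.pi ν).nonempty_of_neZero
    obtain ⟨a'⟩ : Nonempty (∀ i, β i) := (Measure.pi ν').nonempty_of_neZero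
    exact measureReal_nonneg.trans (h a a')
  refine ENNReal.toReal_le_of_le_ofReal hb ?_
  have hf : Measurable (E'.indicator (1 : (_ × _) → ENNReal)) := measurable_one.indicator hm
  rw [← lintegral_indicator_one hm, lintegral_prod _ hf.aemeasurable,
    lintegral_prod _ hf.lintegral_prod_right'.aemeasurable]
  have hinner : ∀ a, ∫⁻ x, ∫⁻ q, E'.indicator (1 : (_ × _) → ENNReal) ((a, x), q)
      ∂((Measure.pi ν').prod (ν' i)) ∂(ν i) ≤ ENNReal.ofReal b := by
    intro a
    have e1 : ∀ x, ∫⁻ q, E'.indicator (1 : (_ × _) → ENNReal) ((a, x), q)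
        ∂((Measure.pi ν').prod (ν' i)) = ∫⁻ a', ∫⁻ y, E'.indicator (1 : (_ × _) → ENNReal)
          ((a, x), (a', y)) ∂(ν' i) ∂(Measure.pi ν') := fun x =>
      lintegral_prod _ (hf.comp (measurable_const.prodMk measurable_id)).aemeasurable
    simp_rw [e1]
    -- Moves the frozen `a'` outside the integral over the fresh `x`, leaving the two fresh
    -- coordinates innermost.
    rw [lintegral_lintegral_swap]
    · calc _ ≤ ∫⁻ _a', ENNReal.ofReal b ∂(Measure.pi ν') := ?_
        _ = ENNReal.ofReal b := by simp
      refine lintegral_mono fun a' => ?_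
      have hg : Measurable fun x : α i × β i => ((a, x.1), (a', x.2)) := by fun_prop
      have e2 := lintegral_prod (μ := ν i) (ν := ν' i)
        (fun x : α i × β i => E'.indicator (1 : (_ × _) → ENNReal) ((a, x.1), (a', x.2)))
        (hf.comp hg).aemeasurable
      simp only at e2 ⊢
      rw [← e2]
      have e3 : (fun x : α i × β i => E'.indicator (1 : (_ × _) → ENNReal) ((a, x.1), (a', x.2))) =
          ((fun x : α i × β i => ((a, x.1), (a', x.2))) ⁻¹' E').indicator 1 := by
        rfl
      rw [e3, lintegral_indicator_one (hg hm)]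
      exact (ENNReal.le_ofReal_iff_toReal_le (measure_ne_top _ _) hb).2 (h a a')
    · have hg : Measurable fun z : α i × (∀ i, β i) × β i => ((a, z.1), z.2) := by fun_prop
      have := (hf.comp (g := E'.indicator (1 : (_ × _) → ENNReal))
        (f := fun z : (α i × ∀ i, β i) × β i => ((a, z.1.1), (z.1.2, z.2))) (by fun_prop))
      exact this.lintegral_prod_right'.aemeasurable
  calc _ ≤ ∫⁻ _a, ENNReal.ofReal b ∂(Measure.pi ν) := lintegral_mono hinner
    _ = ENNReal.ofReal b := by simp

/-- Two independent samples from the same distribution form one sample. -/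
theorem measurePreserving_fin_append {Z : Type*} [MeasurableSpace Z] (μ : Measure Z)
    [IsProbabilityMeasure μ] (n m : ℕ) :
    MeasurePreserving (fun p : (Fin n → Z) × (Fin m → Z) => Fin.append p.1 p.2)
      ((Measure.pi fun _ => μ).prod (Measure.pi fun _ => μ)) (Measure.pi fun _ => μ) := by
  have hm : Measurable fun p : (Fin n → Z) × (Fin m → Z) => Fin.append p.1 p.2 := by
    refine measurable_pi_lambda _ fun j => ?_
    refine Fin.addCases (fun l => ?_) (fun l => ?_) j
    · simp only [Fin.append_left]; fun_prop
    · simp only [Fin.append_right]; fun_prop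
  refine ⟨hm, (Measure.pi_eq fun s hs => ?_).symm⟩
  have hpre : (fun p : (Fin n → Z) × (Fin m → Z) => Fin.append p.1 p.2) ⁻¹' Set.univ.pi s =
      (Set.univ.pi fun j => s (Fin.castAdd m j)) ×ˢ (Set.univ.pi fun j => s (Fin.natAdd n j)) := by
    ext p
    simp only [Set.mem_preimage, Set.mem_univ_pi, Set.mem_prod, Fin.forall_fin_add,
      Fin.append_left, Fin.append_right]
  rw [Measure.map_apply hm (MeasurableSet.univ_pi hs), hpre, Measure.prod_prod, Measure.pi_pi,
    Measure.pi_pi, Fin.prod_univ_add]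

end Product

/-! ### Risks, mixtures and generalization bounds on one sample -/

section Risk

theorem subgraph_image_loss {X Y A : Type*} (L : Y → A → ℝ) (H : Set (X → A)) :
    subgraph '' ((fun (h : X → A) (z : X × Y) => L z.2 (h z.1)) '' H) = lossSubgraph L '' H := by
  rw [Set.image_image]; rfl

variable {X Y A : Type*} [MeasurableSpace X] [MeasurableSpace Y] [MeasurableSpace A]
  {L : Y → A → ℝ}

theorem measurable_loss {Ω : Type*} [MeasurableSpace Ω] (hL : Measurable (Function.uncurry L))
    {F : Ω → X → A} (hF : Measurable fun p : Ω × X => F p.1 p.2) :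
    Measurable fun p : Ω × (X × Y) => L p.2.2 (F p.1 p.2.1) :=
  hL.comp (measurable_snd.snd.prodMk
    (hF.comp (measurable_fst.prodMk measurable_snd.fst)))

theorem measurable_risk {Ω : Type*} [MeasurableSpace Ω] (hL : Measurable (Function.uncurry L))
    {F : Ω → X → A} (hF : Measurable fun p : Ω × X => F p.1 p.2) (P : Measure (X × Y)) [SFinite P] :
    Measurable fun ω => risk L P (F ω) :=
  ((measurable_loss hL hF).stronglyMeasurable.integral_prod_right (ν := P)).measurable

theorem measurable_empRisk {Ω : Type*} [MeasurableSpace Ω] (hL : Measurable (Function.uncurry L))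
    {F : Ω → X → A} (hF : Measurable fun p : Ω × X => F p.1 p.2) {k : ℕ}
    {D : Ω → Fin k → X × Y} (hD : Measurable D) :
    Measurable fun ω => empRisk L (D ω) (F ω) := by
  unfold empRisk
  refine measurable_const.mul (Finset.measurable_sum _ fun j _ => ?_)
  exact (measurable_loss hL hF).comp (measurable_id.prodMk ((measurable_pi_apply j).comp hD))

theorem integrable_loss (hL : Measurable (Function.uncurry L)) {c : ℝ} (hc : ∀ y a, |L y a| ≤ c)
    {h : X → A} (hh : Measurable h) (P : Measure (X × Y)) [IsFiniteMeasure P] :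
    Integrable (fun z : X × Y => L z.2 (h z.1)) P :=
  Integrable.of_bound (hL.comp (measurable_snd.prodMk
    (hh.comp measurable_fst))).aestronglyMeasurable c (Filter.Eventually.of_forall fun _ => hc _ _)

theorem mixture_eq_sum {d : ℕ} (w : Fin d → ℝ) (PX : Fin d → Measure X)
    [∀ i, IsProbabilityMeasure (PX i)] (κ : Kernel X Y) [IsMarkovKernel κ] :
    mixture w PX κ = ∑ i, ENNReal.ofReal (w i) • (PX i ⊗ₘ κ) := by
  unfold mixture
  have := fun i => Measure.smul_finite (PX i) (c := ENNReal.ofReal (w i)) ENNReal.ofReal_ne_top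
  rw [← Measure.sum_fintype, Measure.compProd_sum_left, Measure.sum_fintype]
  exact Finset.sum_congr rfl fun i _ => Measure.compProd_smul_left _

theorem risk_mixture (hL : Measurable (Function.uncurry L)) {c : ℝ} (hc : ∀ y a, |L y a| ≤ c)
    {d : ℕ} {w : Fin d → ℝ} (hw : ∀ i, 0 ≤ w i) (PX : Fin d → Measure X)
    [∀ i, IsProbabilityMeasure (PX i)] (κ : Kernel X Y) [IsMarkovKernel κ] {h : X → A}
    (hh : Measurable h) :
    risk L (mixture w PX κ) h = ∑ i, w i * risk L (PX i ⊗ₘ κ) h := by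
  unfold risk
  rw [mixture_eq_sum, integral_finsetSum_measure]
  · refine Finset.sum_congr rfl fun i _ => ?_
    rw [integral_smul_measure, ENNReal.toReal_ofReal (hw i), smul_eq_mul]
  · exact fun i _ => (integrable_loss hL hc hh _).smul_measure ENNReal.ofReal_ne_top

variable {P : Measure (X × Y)} [IsProbabilityMeasure P] {c δ : ℝ} {k : ℕ}

/-- Generalization bound for a data-dependent member of a hypothesis space. -/
theorem measure_risk_sub_empRisk_le (hL : Measurable (Function.uncurry L)) (hc0 : 0 ≤ c)
    (hc : ∀ y a, |L y a| ≤ c) {H : Set (X → A)} {v : ℕ} (hVC : hypVCDim L H ≤ v)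
    {F : (Fin k → X × Y) → X → A} (hFH : ∀ D, F D ∈ H)
    (hF : Measurable fun p : (Fin k → X × Y) × X => F p.1 p.2) (hδ : 0 < δ) (hδ1 : δ < 1)
    (hk : 2 ≤ k ∨ k = 1 ∧ 1 ≤ Real.log (1 / δ)) :
    (Measure.pi fun _ : Fin k => P).real
      {D | deviationConst c * √((v * Real.log k + Real.log (1 / δ)) / k) <
        risk L P (F D) - empRisk L D (F D)} ≤ δ := by
  refine measure_vc_deviation_le (𝒢 := (fun (h : X → A) (z : X × Y) => L z.2 (h z.1)) '' H)
    (G := fun D z => L z.2 (F D z.1)) hc0 ?_ ?_ (fun D => ⟨F D, hFH D, rfl⟩)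
    (measurable_loss hL hF) hδ hδ1 hk
  · rintro _ ⟨h, -, rfl⟩ z
    exact hc _ _
  · rw [subgraph_image_loss]; exact hVC

/-- Deviation of the empirical risk of a fixed predictor from its risk. -/
theorem measure_empRisk_sub_risk_le (hL : Measurable (Function.uncurry L)) (hc0 : 0 ≤ c)
    (hc : ∀ y a, |L y a| ≤ c) {h : X → A} (hh : Measurable h) (hδ : 0 < δ) (hδ1 : δ < 1)
    (hk : 2 ≤ k ∨ k = 1 ∧ 1 ≤ Real.log (1 / δ)) :
    (Measure.pi fun _ : Fin k => P).real
      {D | deviationConst c * √(Real.log (1 / δ) / k) < empRisk L D h - risk L P h} ≤ δ := by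
  -- The dimension-zero case for the single function `-L`; the sign turns the one-sided bound
  -- around.
  have := measure_vc_deviation_le (μ := P) (k := k) (v := 0) (c := c) (δ := δ)
    (𝒢 := {fun z : X × Y => -L z.2 (h z.1)}) (G := fun _ z => -L z.2 (h z.1)) hc0
    (by simp [hc]) (by rw [Set.image_singleton]; simpa using vcDim_singleton_le_zero _)
    (fun D => rfl) ((measurable_loss (Ω := Fin k → X × Y) (F := fun _ => h) hL
      (hh.comp measurable_snd)).neg) hδ hδ1 hk
  have e : ∀ D : Fin k → X × Y, empRisk L D h - risk L P h =
      ∫ z, -L z.2 (h z.1) ∂P - (k : ℝ)⁻¹ * ∑ j, -L (D j).2 (h (D j).1) := by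
    intro D
    rw [integral_neg, Finset.sum_neg_distrib, empRisk, risk]
    ring
  simp_rw [e]
  simpa only [Nat.cast_zero, zero_mul, zero_add] using this

end Risk

/-- Replacing the denominator `K = w * N` by `N` costs exactly `1 / √w`, and `log K ≤ log N`. -/
theorem sqrt_rate_le {w : ℝ} {K N v : ℕ} {ℓ : ℝ} (hw : 0 < w) (hw1 : w ≤ 1) (hN : 0 < N)
    (hK : (K : ℝ) = w * N) :
    √((v * Real.log K + ℓ) / K) ≤ 1 / √w * √((v * Real.log N + ℓ) / N) := by
  have hN' : (0 : ℝ) < N := by exact_mod_cast hN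
  have hK' : (0 : ℝ) < K := by rw [hK]; positivity
  have hKN : (K : ℝ) ≤ N := by rw [hK]; nlinarith
  have h1 : 1 / √w * √((v * Real.log N + ℓ) / N) = √((v * Real.log N + ℓ) / K) := by
    have h2 : 1 / √w = √(1 / w) := by rw [Real.sqrt_div' _ hw.le, Real.sqrt_one]
    rw [h2, ← Real.sqrt_mul (by positivity), hK]
    congr 1
    field_simp
  rw [h1]
  gcongr

/-! ### Deviation events for the two families of samples -/

section Aggregation

variable {X Y A : Type*} [MeasurableSpace X] [MeasurableSpace Y] [MeasurableSpace A]
  {L : Y → A → ℝ} {d : ℕ} {nS mS : Fin d → ℕ} {PX : Fin d → Measure X}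
  [∀ i, IsProbabilityMeasure (PX i)] {κ : Kernel X Y} [IsMarkovKernel κ] {c δ : ℝ}

instance isProbabilityMeasure_sampleLaw : IsProbabilityMeasure (sampleLaw nS PX κ) := by
  unfold sampleLaw; infer_instance

/-- Generalization bound for the domain experts. -/
theorem measure_expert_deviation_le (hL : Measurable (Function.uncurry L)) (hc0 : 0 ≤ c)
    (hc : ∀ y a, |L y a| ≤ c) {H : Set (X → A)} {v : ℕ} (hVC : hypVCDim L H ≤ v) (i : Fin d)
    {f : (Fin (nS i) → X × Y) → X → A} (hf : Measurable fun p : (Fin (nS i) → X × Y) × X => f p.1 p.2)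
    (hfH : ∀ D, f D ∈ H) (hδ : 0 < δ) (hδ1 : δ < 1)
    (hk : 2 ≤ nS i ∨ nS i = 1 ∧ 1 ≤ Real.log (1 / δ)) :
    ((sampleLaw nS PX κ).prod (sampleLaw mS PX κ)).real
      {ω | deviationConst c * √((v * Real.log (nS i) + Real.log (1 / δ)) / nS i) <
        risk L (PX i ⊗ₘ κ) (f (ω.1 i)) - empRisk L (ω.1 i) (f (ω.1 i))} ≤ δ := by
  have hmp := (measurePreserving_eval (fun i => Measure.pi fun _ : Fin (nS i) => PX i ⊗ₘ κ) i).comp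
    (measurePreserving_fst (μ := sampleLaw nS PX κ) (ν := sampleLaw mS PX κ))
  have hm : MeasurableSet {D : Fin (nS i) → X × Y |
      deviationConst c * √((v * Real.log (nS i) + Real.log (1 / δ)) / nS i) <
        risk L (PX i ⊗ₘ κ) (f D) - empRisk L D (f D)} :=
    measurableSet_lt measurable_const
      ((measurable_risk hL hf _).sub (measurable_empRisk hL hf measurable_id))
  have := measure_risk_sub_empRisk_le (P := PX i ⊗ₘ κ) hL hc0 hc hVC hfH hf hδ hδ1 hk
  rwa [measureReal_def, ← hmp.measure_preimage hm.nullMeasurableSet, ← measureReal_def] at this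

/-- Deviation of the empirical risks of the domain experts on the second sample. -/
theorem measure_expert_holdout_deviation_le (hL : Measurable (Function.uncurry L)) (hc0 : 0 ≤ c)
    (hc : ∀ y a, |L y a| ≤ c) (i : Fin d)
    {f : (Fin (nS i) → X × Y) → X → A} (hf : Measurable fun p : (Fin (nS i) → X × Y) × X => f p.1 p.2)
    (hδ : 0 < δ) (hδ1 : δ < 1) (hk : 2 ≤ mS i ∨ mS i = 1 ∧ 1 ≤ Real.log (1 / δ)) :
    ((sampleLaw nS PX κ).prod (sampleLaw mS PX κ)).real
      {ω | deviationConst c * √(Real.log (1 / δ) / mS i) <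
        empRisk L (ω.2 i) (f (ω.1 i)) - risk L (PX i ⊗ₘ κ) (f (ω.1 i))} ≤ δ := by
  have hf' : Measurable fun p : (Samples X Y nS × Samples X Y mS) × X => f (p.1.1 i) p.2 :=
    hf.comp (f := fun p : (Samples X Y nS × Samples X Y mS) × X => (p.1.1 i, p.2))
      (((measurable_pi_apply i).comp measurable_fst.fst).prodMk measurable_snd)
  have hE : MeasurableSet {ω : Samples X Y nS × Samples X Y mS |
      deviationConst c * √(Real.log (1 / δ) / mS i) <
        empRisk L (ω.2 i) (f (ω.1 i)) - risk L (PX i ⊗ₘ κ) (f (ω.1 i))} :=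
    measurableSet_lt measurable_const ((measurable_empRisk hL hf'
      ((measurable_pi_apply i).comp measurable_snd)).sub (measurable_risk hL hf' _))
  -- With the first sample fixed the expert is a fixed predictor, so no VC term appears.
  refine measureReal_prod_le_of_forall hE fun D => ?_
  refine measureReal_pi_le_of_update i (measurable_prodMk_left hE) fun D' => ?_
  have hh : Measurable (f (D i)) := hf.comp (measurable_const.prodMk measurable_id)
  simpa using measure_empRisk_sub_risk_le (P := PX i ⊗ₘ κ) hL hc0 hc hh hδ hδ1 hk

/-- Generalization bound for the aggregated predictor on the second sample. -/
theorem measure_aggregate_deviation_le (hL : Measurable (Function.uncurry L)) (hc0 : 0 ≤ c)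
    (hc : ∀ y a, |L y a| ≤ c) {H : Set (X → A)} {v : ℕ} (hVC : hypVCDim L H ≤ v) (i : Fin d)
    {F : Samples X Y nS × Samples X Y mS → X → A}
    (hF : Measurable fun p : (Samples X Y nS × Samples X Y mS) × X => F p.1 p.2)
    (hFH : ∀ ω, F ω ∈ H) (hδ : 0 < δ) (hδ1 : δ < 1)
    (hk : 2 ≤ mS i ∨ mS i = 1 ∧ 1 ≤ Real.log (1 / δ)) :
    ((sampleLaw nS PX κ).prod (sampleLaw mS PX κ)).real
      {ω | deviationConst c * √((v * Real.log (mS i) + Real.log (1 / δ)) / mS i) <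
        risk L (PX i ⊗ₘ κ) (F ω) - empRisk L (ω.2 i) (F ω)} ≤ δ := by
  have hE : MeasurableSet {ω : Samples X Y nS × Samples X Y mS |
      deviationConst c * √((v * Real.log (mS i) + Real.log (1 / δ)) / mS i) <
        risk L (PX i ⊗ₘ κ) (F ω) - empRisk L (ω.2 i) (F ω)} :=
    measurableSet_lt measurable_const ((measurable_risk hL hF _).sub
      (measurable_empRisk hL hF ((measurable_pi_apply i).comp measurable_snd)))
  refine measureReal_prod_le_of_forall hE fun D => ?_
  -- The aggregate still depends on the one sample left random, hence the VC bound over its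
  -- hypothesis space.
  refine measureReal_pi_le_of_update i (measurable_prodMk_left hE) fun D' => ?_
  have hG : Measurable fun p : (Fin (mS i) → X × Y) × X => F (D, Function.update D' i p.1) p.2 :=
    hF.comp ((measurable_const.prodMk ((measurable_update D').comp measurable_fst)).prodMk
      measurable_snd)
  simpa using measure_risk_sub_empRisk_le (P := PX i ⊗ₘ κ) hL hc0 hc hVC
    (F := fun x => F (D, Function.update D' i x)) (fun x => hFH _) hG hδ hδ1 hk

/-- Generalization bound for a predictor learned from the union of the two samples. -/
theorem measure_union_deviation_le (hL : Measurable (Function.uncurry L)) (hc0 : 0 ≤ c)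
    (hc : ∀ y a, |L y a| ≤ c) {H : Set (X → A)} {v : ℕ} (hVC : hypVCDim L H ≤ v) (i : Fin d)
    {F : Samples X Y nS × Samples X Y mS → X → A}
    (hF : Measurable fun p : (Samples X Y nS × Samples X Y mS) × X => F p.1 p.2)
    (hFH : ∀ ω, F ω ∈ H) (hδ : 0 < δ) (hδ1 : δ < 1) (hk : 2 ≤ nS i + mS i) :
    ((sampleLaw nS PX κ).prod (sampleLaw mS PX κ)).real
      {ω | deviationConst c *
          √((v * Real.log (nS i + mS i : ℕ) + Real.log (1 / δ)) / (nS i + mS i : ℕ)) <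
        risk L (PX i ⊗ₘ κ) (F ω) - empRisk L (Fin.append (ω.1 i) (ω.2 i)) (F ω)} ≤ δ := by
  have happ := measurePreserving_fin_append (PX i ⊗ₘ κ) (nS i) (mS i)
  have hE : MeasurableSet {ω : Samples X Y nS × Samples X Y mS | deviationConst c *
          √((v * Real.log (nS i + mS i : ℕ) + Real.log (1 / δ)) / (nS i + mS i : ℕ)) <
        risk L (PX i ⊗ₘ κ) (F ω) - empRisk L (Fin.append (ω.1 i) (ω.2 i)) (F ω)} :=
    measurableSet_lt measurable_const ((measurable_risk hL hF _).sub
      (measurable_empRisk hL hF (happ.measurable.comp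
        (f := fun ω : Samples X Y nS × Samples X Y mS => (ω.1 i, ω.2 i)) (((measurable_pi_apply i).comp measurable_fst).prodMk
          ((measurable_pi_apply i).comp measurable_snd)))))
  refine measureReal_pi_prod_pi_le_of_update i hE fun D D' => ?_
  -- Cutting one sample of size `nS i + mS i` into two pieces makes the learned predictor a function
  -- of a single sample.
  set G : (Fin (nS i + mS i) → X × Y) → X → A := fun x =>
    F (Function.update D i fun j => x (Fin.castAdd _ j),
      Function.update D' i fun j => x (Fin.natAdd _ j)) with hGdef
  have hG : Measurable fun p : (Fin (nS i + mS i) → X × Y) × X => G p.1 p.2 := by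
    refine hF.comp ((Measurable.prodMk ((measurable_update D).comp ?_)
      ((measurable_update D').comp ?_)).prodMk measurable_snd) <;> fun_prop
  have hm : MeasurableSet {x : Fin (nS i + mS i) → X × Y | deviationConst c *
          √((v * Real.log (nS i + mS i : ℕ) + Real.log (1 / δ)) / (nS i + mS i : ℕ)) <
        risk L (PX i ⊗ₘ κ) (G x) - empRisk L x (G x)} :=
    measurableSet_lt measurable_const
      ((measurable_risk hL hG _).sub (measurable_empRisk hL hG measurable_id))
  have := measure_risk_sub_empRisk_le (P := PX i ⊗ₘ κ) hL hc0 hc hVC (F := G)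
    (fun x => hFH _) hG hδ hδ1 (Or.inl hk)
  rw [measureReal_def, ← happ.measure_preimage hm.nullMeasurableSet, ← measureReal_def] at this
  simpa [hGdef] using this

end Aggregation

/-! ### Union bounds and the main theorem -/

/-- Only subadditivity is used, so neither the good nor the bad set has to be measurable. -/
theorem one_sub_le_measureReal_of_compl_subset {Ω : Type*} [MeasurableSpace Ω] {P : Measure Ω}
    [IsProbabilityMeasure P] {S B : Set Ω} {b : ℝ} (hS : Sᶜ ⊆ B) (hB : P.real B ≤ b) :
    1 - b ≤ P.real S := by
  have h1 : P.real (S ∪ B) = 1 := by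
    have : S ∪ B = Set.univ := Set.eq_univ_of_forall fun ω => by
      by_cases h : ω ∈ S
      · exact Or.inl h
      · exact Or.inr (hS h)
    rw [this]; simp
  have h2 := measureReal_union_le (μ := P) S B
  linarith

theorem deviationConst_pos {c : ℝ} (hc : 0 ≤ c) : 0 < deviationConst c := by
  unfold deviationConst; positivity

theorem one_div_sqrt_le_sum {d : ℕ} (w : Fin d → ℝ) (i : Fin d) :
    1 / √(w i) ≤ ∑ j, 1 / √(w j) :=
  Finset.single_le_sum (f := fun j => 1 / √(w j)) (fun _ _ => by positivity) (Finset.mem_univ i)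

theorem theorem1 {d : ℕ} (w : Fin d → ℝ) (hw : ∀ i, 0 ≤ w i) (hwsum : ∑ i, w i = 1) (cL : ℝ) :
    ∃ C : ℝ, 0 < C ∧
      ∀ {X Y A : Type*} [MeasurableSpace X] [MeasurableSpace Y] [MeasurableSpace A]
        -- source domains with common conditional label distribution, and target weights
        (PX : Fin d → Measure X) [∀ i, IsProbabilityMeasure (PX i)]
        (κ : Kernel X Y) [IsMarkovKernel κ]
        (w' : Fin d → ℝ), (∀ i, 0 ≤ w' i) → ∑ i, w' i = 1 → (∀ i, w i = 0 → w' i = 0) →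
        -- the bounded loss
        ∀ (L : Y → A → ℝ), Measurable (Function.uncurry L) → (∀ y a, |L y a| ≤ cL) →
        -- sample sizes
        ∀ (n m : ℕ) (nS mS : Fin d → ℕ), 0 < n → 0 < m →
          (∀ i, (nS i : ℝ) = w i * n) → (∀ i, (mS i : ℝ) = w i * m) →
        -- domain experts and their aggregation
        (∀ (Hi : Fin d → Set (X → A)) (Ht : Set (X → A)) (di : Fin d → ℕ) (dt : ℕ),
          (∀ i, hypVCDim L (Hi i) ≤ di i) → hypVCDim L Ht ≤ dt →
          ∀ (f : (i : Fin d) → (Fin (nS i) → X × Y) → X → A)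
            (agg : (Fin d → X → A) → Samples X Y mS → X → A),
          (∀ i, Measurable fun p : (Fin (nS i) → X × Y) × X => f i p.1 p.2) →
          (Measurable fun p : (Samples X Y nS × Samples X Y mS) × X =>
            agg (fun i => f i (p.1.1 i)) p.1.2 p.2) →
          (∀ (i : Fin d) (D : Fin (nS i) → X × Y), IsMinimizer (empRisk L D) (Hi i) (f i D)) →
          (∀ (D : Samples X Y nS) (D' : Samples X Y mS), agg (fun i => f i (D i)) D' ∈ Ht) →
          (∀ᵐ ω ∂((sampleLaw nS PX κ).prod (sampleLaw mS PX κ)), ∀ i,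
            empRisk L (ω.2 i) (agg (fun i => f i (ω.1 i)) ω.2) ≤
              empRisk L (ω.2 i) (f i (ω.1 i))) →
          ∀ δ : ℝ, 0 < δ → δ < 1 →
            1 - 3 * d * δ ≤ ((sampleLaw nS PX κ).prod (sampleLaw mS PX κ)).real
              {ω | risk L (mixture w' PX κ) (agg (fun i => f i (ω.1 i)) ω.2)
                    - ∑ i, w' i * empRisk L (ω.1 i) (f i (ω.1 i)) ≤
                  (∑ i, w' i / √(w i)) * √(cL * Real.log (1 / δ) / (2 * m))
                  + C * √((dt * Real.log m + Real.log (1 / δ)) / m)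
                  + C * ∑ i, w' i * √((di i * Real.log (nS i) + Real.log (1 / δ)) / nS i)}) ∧
        -- the universal empirical risk minimizer on the union of the two samples
        (∀ (H : Set (X → A)) (d₀ : ℕ), hypVCDim L H ≤ d₀ →
          ∀ f : Samples X Y nS × Samples X Y mS → X → A,
          (Measurable fun p : (Samples X Y nS × Samples X Y mS) × X => f p.1 p.2) →
          (∀ ω, IsMinimizer
            (fun h => ∑ i, w i * empRisk L (Fin.append (ω.1 i) (ω.2 i)) h) H (f ω)) →
          ∀ δ : ℝ, 0 < δ → δ < 1 →
            1 - d * δ ≤ ((sampleLaw nS PX κ).prod (sampleLaw mS PX κ)).real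
              {ω | risk L (mixture w' PX κ) (f ω)
                    - ∑ i, w' i * empRisk L (Fin.append (ω.1 i) (ω.2 i)) (f ω) ≤
                  C * √((d₀ * Real.log (n + m : ℕ) + Real.log (1 / δ)) / (n + m : ℕ))}) := by
  set c := |cL|
  have hc0 : 0 ≤ c := abs_nonneg _
  set C₀ := deviationConst c
  have hC₀pos : 0 < C₀ := deviationConst_pos hc0
  -- Domains of weight zero contribute nothing, since `1 / √0 = 0`.
  set Q := ∑ j, 1 / √(w j)
  have hQ0 : 0 ≤ Q := Finset.sum_nonneg fun _ _ => by positivity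
  have hw1 : ∀ i, w i ≤ 1 := fun i => hwsum ▸
    Finset.single_le_sum (f := w) (fun _ _ => hw _) (Finset.mem_univ i)
  refine ⟨2 * C₀ * (1 + Q), by positivity, ?_⟩
  intro X Y A _ _ _ PX _ κ _ w' hw' hw'sum hww' L hL hLc n m nS mS hn hm hnS hmS
  have hLc' : ∀ y a, |L y a| ≤ c := fun y a => (hLc y a).trans (le_abs_self cL)
  have hpos : ∀ (N : ℕ) (K : ℕ) (i : Fin d), 0 < N → (K : ℝ) = w i * N → w i ≠ 0 → 1 ≤ K := by
    intro N K i hN hK hi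
    have h1 : (0 : ℝ) < K := by
      rw [hK]
      exact mul_pos (lt_of_le_of_ne (hw i) hi.symm) (by exact_mod_cast hN)
    exact_mod_cast h1
  have hwpos : ∀ i, w i ≠ 0 → 0 < w i := fun i hi => lt_of_le_of_ne (hw i) hi.symm
  have hd : 1 ≤ d := by
    rcases Nat.eq_zero_or_pos d with rfl | h
    · simp at hwsum
    · exact h
  have hdR : (1 : ℝ) ≤ d := by exact_mod_cast hd
  constructor
  · intro Hi Ht di dt hVCi hVCt f agg hf hagg hmin haggH hae δ hδ hδ1
    set P := (sampleLaw nS PX κ).prod (sampleLaw mS PX κ)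
    set ℓ := Real.log (1 / δ) with hℓ
    -- Outside the vacuous case `δ < 1 / 3`, so `log (1 / δ) ≥ 1`; this admits domains with a single
    -- observation.
    rcases le_or_gt 1 (3 * d * δ) with htriv | hsmall
    · exact le_trans (by linarith) measureReal_nonneg
    have hδ3 : δ < 1 / 3 := by nlinarith
    have hℓ1 : 1 ≤ ℓ := by
      rw [hℓ, Real.le_log_iff_exp_le (by positivity), le_div_iff₀ hδ]
      nlinarith [Real.exp_one_lt_d9, Real.exp_pos 1]
    have hsize : ∀ K : ℕ, 1 ≤ K → 2 ≤ K ∨ K = 1 ∧ 1 ≤ Real.log (1 / δ) := by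
      intro K hK
      rcases hK.eq_or_lt with h | h
      · exact Or.inr ⟨h.symm, hℓ1⟩
      · exact Or.inl h
    let F : Samples X Y nS × Samples X Y mS → X → A := fun ω => agg (fun i => f i (ω.1 i)) ω.2
    -- The conjunct `w i ≠ 0` empties the bad event of domains without observations, where `w' i =
    -- 0` as well.
    let B : Fin d → Set (Samples X Y nS × Samples X Y mS) := fun i => {ω | w i ≠ 0 ∧
      (C₀ * √((di i * Real.log (nS i) + ℓ) / nS i) <
          risk L (PX i ⊗ₘ κ) (f i (ω.1 i)) - empRisk L (ω.1 i) (f i (ω.1 i)) ∨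
        C₀ * √(ℓ / mS i) < empRisk L (ω.2 i) (f i (ω.1 i)) - risk L (PX i ⊗ₘ κ) (f i (ω.1 i)) ∨
        C₀ * √((dt * Real.log (mS i) + ℓ) / mS i) <
          risk L (PX i ⊗ₘ κ) (F ω) - empRisk L (ω.2 i) (F ω))}
    have hB : ∀ i, P.real (B i) ≤ 3 * δ := by
      intro i
      by_cases hi : w i = 0
      · have : B i = ∅ := by ext ω; simp [B, hi]
        rw [this]; simp [hδ.le]
      · have hni := hsize _ (hpos n (nS i) i hn (hnS i) hi)
        have hmi := hsize _ (hpos m (mS i) i hm (hmS i) hi)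
        have h1 := measure_expert_deviation_le (mS := mS) (PX := PX) (κ := κ) hL hc0 hLc' (hVCi i) i
          (hf i) (fun D => (hmin i D).1) hδ hδ1 hni
        have h2 := measure_expert_holdout_deviation_le (PX := PX) (κ := κ) hL hc0 hLc' i (hf i)
          hδ hδ1 hmi
        have h3 := measure_aggregate_deviation_le (PX := PX) (κ := κ) (F := F) hL hc0 hLc' hVCt i
          hagg (fun ω => haggH ω.1 ω.2) hδ hδ1 hmi
        refine (measureReal_mono (fun ω hω => hω.2)).trans
          (((measureReal_union_le _ _).trans (add_le_add h1
            ((measureReal_union_le _ _).trans (add_le_add h2 h3)))).trans (by linarith))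
    set N₀ := {ω : Samples X Y nS × Samples X Y mS | ¬ ∀ i, empRisk L (ω.2 i) (F ω) ≤
      empRisk L (ω.2 i) (f i (ω.1 i))}
    have hN₀ : P.real N₀ = 0 := by
      rw [measureReal_def, (ae_iff.1 hae : P N₀ = 0)]; simp
    refine one_sub_le_measureReal_of_compl_subset (B := N₀ ∪ ⋃ i, B i) ?_ ?_
    · rw [Set.compl_subset_comm]
      intro ω hω
      simp only [Set.mem_compl_iff, Set.mem_union, Set.mem_iUnion, not_or, not_exists] at hω
      obtain ⟨hωN, hωB⟩ := hω
      have hcomp : ∀ i, empRisk L (ω.2 i) (F ω) ≤ empRisk L (ω.2 i) (f i (ω.1 i)) :=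
        not_not.1 hωN
      simp only [Set.mem_ofPred_eq]
      have hFm : Measurable (F ω) := hagg.comp (measurable_const.prodMk measurable_id)
      change risk L (mixture w' PX κ) (F ω) - _ ≤ _
      rw [risk_mixture hL hLc' hw' PX κ hFm, ← Finset.sum_sub_distrib]
      set a := √((dt * Real.log m + ℓ) / m)
      have ha0 : 0 ≤ a := Real.sqrt_nonneg _
      have hterm : ∀ i, w' i * risk L (PX i ⊗ₘ κ) (F ω) - w' i * empRisk L (ω.1 i) (f i (ω.1 i)) ≤
          w' i * (2 * C₀ * Q * a) + C₀ * (w' i * √((di i * Real.log (nS i) + ℓ) / nS i)) := by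
        intro i
        by_cases hi : w i = 0
        · simp [hww' i hi]
        have hBi : ¬ _ := fun h => hωB i ⟨hi, h⟩
        rw [not_or, not_or, not_lt, not_lt, not_lt] at hBi
        obtain ⟨h1, h2, h3⟩ := hBi
        have h4 := hcomp i
        have hmi : (1 : ℝ) ≤ mS i := by exact_mod_cast hpos m (mS i) i hm (hmS i) hi
        have h5 : √((dt * Real.log (mS i) + ℓ) / mS i) ≤ Q * a :=
          (sqrt_rate_le (hwpos i hi) (hw1 i) hm (hmS i)).trans
            (mul_le_mul_of_nonneg_right (one_div_sqrt_le_sum w i) ha0)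
        have h6 : √(ℓ / mS i) ≤ √((dt * Real.log (mS i) + ℓ) / mS i) := by
          have : 0 ≤ dt * Real.log (mS i) := mul_nonneg (Nat.cast_nonneg _) (Real.log_nonneg hmi)
          gcongr
          linarith
        have h7 := mul_le_mul_of_nonneg_left h5 hC₀pos.le
        have h8 := mul_le_mul_of_nonneg_left (h6.trans h5) hC₀pos.le
        -- Chains `h3`, `h4`, `h2`, `h1`. Both deviations on the second sample are at most `C₀ * Q *
        -- a`, whence the factor 2 in the constant.
        have h9 : risk L (PX i ⊗ₘ κ) (F ω) - empRisk L (ω.1 i) (f i (ω.1 i)) ≤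
            2 * C₀ * Q * a + C₀ * √((di i * Real.log (nS i) + ℓ) / nS i) := by linarith
        have := mul_le_mul_of_nonneg_left h9 (hw' i)
        linarith
      refine (Finset.sum_le_sum fun i _ => hterm i).trans ?_
      rw [Finset.sum_add_distrib, ← Finset.sum_mul, hw'sum, one_mul, ← Finset.mul_sum]
      -- The holdout deviation is already inside `2 * C₀ * Q * a`, so the first summand of the bound
      -- enters only through its sign.
      have hfirst : 0 ≤ (∑ i, w' i / √(w i)) * √(cL * ℓ / (2 * m)) :=
        mul_nonneg (Finset.sum_nonneg fun i _ => div_nonneg (hw' i) (Real.sqrt_nonneg _))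
          (Real.sqrt_nonneg _)
      set T := ∑ i, w' i * √((di i * Real.log (nS i) + ℓ) / nS i)
      have hT0 : 0 ≤ T := Finset.sum_nonneg fun i _ => mul_nonneg (hw' i) (Real.sqrt_nonneg _)
      have e1 : 0 ≤ C₀ * a := by positivity
      have e2 : 0 ≤ C₀ * T := by positivity
      have e3 : 0 ≤ C₀ * Q * T := by positivity
      linarith
    · calc P.real (N₀ ∪ ⋃ i, B i) ≤ P.real N₀ + P.real (⋃ i, B i) := measureReal_union_le _ _
        _ ≤ 0 + ∑ i, P.real (B i) := add_le_add hN₀.le (measureReal_iUnion_fintype_le _)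
        _ ≤ 0 + ∑ _i : Fin d, 3 * δ := by gcongr with i; exact hB i
        _ = 3 * d * δ := by simp; ring
  · intro H d₀ hVC f hf hmin δ hδ hδ1
    set P := (sampleLaw nS PX κ).prod (sampleLaw mS PX κ)
    set ℓ := Real.log (1 / δ) with hℓ
    let B : Fin d → Set (Samples X Y nS × Samples X Y mS) := fun i => {ω | w i ≠ 0 ∧
      C₀ * √((d₀ * Real.log (nS i + mS i : ℕ) + ℓ) / (nS i + mS i : ℕ)) <
        risk L (PX i ⊗ₘ κ) (f ω) - empRisk L (Fin.append (ω.1 i) (ω.2 i)) (f ω)}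
    have hB : ∀ i, P.real (B i) ≤ δ := by
      intro i
      by_cases hi : w i = 0
      · have : B i = ∅ := by ext ω; simp [B, hi]
        rw [this]; simp [hδ.le]
      · have hni := hpos n (nS i) i hn (hnS i) hi
        have hmi := hpos m (mS i) i hm (hmS i) hi
        -- Both samples of the domain are nonempty, so their union has at least two points and no
        -- lower bound on `log (1 / δ)` is needed.
        exact (measureReal_mono (fun ω hω => hω.2)).trans
          (measure_union_deviation_le (PX := PX) (κ := κ) hL hc0 hLc' hVC i hf
            (fun ω => (hmin ω).1) hδ hδ1 (by omega))
    refine one_sub_le_measureReal_of_compl_subset (B := ⋃ i, B i) ?_ ?_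
    · rw [Set.compl_subset_comm]
      intro ω hω
      simp only [Set.mem_compl_iff, Set.mem_iUnion, not_exists] at hω
      simp only [Set.mem_ofPred_eq]
      have hFm : Measurable (f ω) := hf.comp (measurable_const.prodMk measurable_id)
      rw [risk_mixture hL hLc' hw' PX κ hFm, ← Finset.sum_sub_distrib]
      set a := √((d₀ * Real.log (n + m : ℕ) + ℓ) / (n + m : ℕ))
      have ha0 : 0 ≤ a := Real.sqrt_nonneg _
      have hterm : ∀ i, w' i * risk L (PX i ⊗ₘ κ) (f ω) -
          w' i * empRisk L (Fin.append (ω.1 i) (ω.2 i)) (f ω) ≤ w' i * (C₀ * (Q * a)) := by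
        intro i
        by_cases hi : w i = 0
        · simp [hww' i hi]
        have hBi := not_lt.1 fun h => hω i ⟨hi, h⟩
        have h5 : √((d₀ * Real.log (nS i + mS i : ℕ) + ℓ) / (nS i + mS i : ℕ)) ≤ Q * a :=
          (sqrt_rate_le (N := n + m) (hwpos i hi) (hw1 i) (by omega)
            (by push_cast; rw [hnS, hmS]; ring)).trans
            (mul_le_mul_of_nonneg_right (one_div_sqrt_le_sum w i) ha0)
        rw [← mul_sub]
        exact mul_le_mul_of_nonneg_left
          (hBi.trans (mul_le_mul_of_nonneg_left h5 hC₀pos.le)) (hw' i)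
      refine (Finset.sum_le_sum fun i _ => hterm i).trans ?_
      rw [← Finset.sum_mul, hw'sum, one_mul]
      have e1 : 0 ≤ C₀ * a := by positivity
      have e2 : 0 ≤ C₀ * Q * a := by positivity
      linarith
    · calc P.real (⋃ i, B i) ≤ ∑ i, P.real (B i) := measureReal_iUnion_fintype_le _
        _ ≤ ∑ _i : Fin d, δ := by gcongr with i; exact hB i
        _ = d * δ := by simp
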